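/- **Setting.** A *ternary semigroup* is a commutative monoid $(F,\cdot,1)$ with an absorbing element $0$ and a distinguished element $-1$ such that $x^3=x$ for all $x$, $-1\neq 1$, $(-1)^2=1$, and $x=-x$ implies $x=0$, where $-x:=(-1)\cdot x$. A *real semigroup* is a ternary semigroup with a ternary relation $a\in D(b,c)$ satisfying the Dickmann–Petrovich axioms, where $a\in D^t(b,c)$ means $a\in D(b,c)$, $-b\in D(-a,c)$ and $-c\in D(b,-a)$: (0) $D(a,b)=D(b,a)$; (1) $a\in D(a,b)$; (2) $a\in D(b,c)$ implies $ad\in D(bd,cd)$; (3) if $a\in D^t(b,c)$ and $c\in D^t(d,e)$, there is $x\in D^t(b,d)$ with $a\in D^t(x,e)$; (4) $e\in D(c^2a,d^2b)$ implies $e\in D(a,b)$; (5) if $ad=bd$, $ae=be$ and $c\in D(d,e)$, then $ac=bc$; (6) $c\in D(a,b)$ implies $c\in D^t(c^2a,c^2b)$; (7) $D^t(a,-b)\cap D^t(b,-a)\neq\emptyset$ implies $a=b$; (8) $a\in D(b,c)$ implies $a^2\in D(b^2,c^2)$. The set $\mathbf 3=\{1,0,-1\}$ is a real semigroup with $D(b,c)=\{0,b,c\}$.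 The character space $X_F$ is the set of real semigroup homomorphisms $F\to\mathbf 3$, with the spectral topology generated by the sets $\{h : h(a)=1\}$, $a\in F$; $g\rightsquigarrow h$ means that $h$ is a specialization of $g$, i.e. $h\in\overline{\{g\}}$. We write $Z(h)=h^{-1}(0)$. $F$ is an *RS-fan* if every ternary semigroup homomorphism $F\to\mathbf 3$ (map preserving $0,1,-1$ and products) lies in $X_F$. Let $F$ be an RS-fan and let $\mathrm{Spec}(F)$ be the set of its proper ideals (subsets $I\neq F$ with $0\in I$ and $FI\subseteq I$). For $I\in\mathrm{Spec}(F)$, the *level* $L_I=\{h\in X_F : Z(h)=I\}$ is equipped with the group $F_I$ of all functions $L_I\to\{\pm1\}$, $h\mapsto h(a)$, with $a\in F\setminus I$. A pair $(X,G)$ is an *abstract order space* (AOS) if $X\neq\emptyset$ and $G$ is a group of functions $X\to\{\pm1\}$ containing the constant $-1$ and separating points such that, with $D(a,b)=\{c\in G : c(x)\in\{a(x),b(x)\}\ \forall x\in X\}$: every group character $\chi:G\to\{\pm1\}$ with $\chi(-1)=-1$ and with $D(a,b)\subseteq\ker\chi$ for all $a,b\in\ker\chi$ is evaluation at a point of $X$;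 and if $t\in D(a,r)$ with $r\in D(b,c)$, then $t\in D(s,c)$ for some $s\in D(a,b)$. A map $\varphi:X\to Y$ is an *AOS-morphism* $(X,G)\to(Y,H)$ if for every $a\in H$ there is $b\in G$ with $a\circ\varphi=b$; an *AOS-automorphism* of $(X,G)$ is a bijection $X\to X$ such that it and its inverse are AOS-morphisms. **Theorem.** Let $F$ be an RS-fan, $g_1,g_2\in X_F$, and $I\in\mathrm{Spec}(F)$ with $Z(g_1),Z(g_2)\subseteq I$. Let $\varphi_I:L_I\to L_I$ be the (well-defined) map $\varphi_I(h)=h\,g_1\,g_2$ (pointwise product). Then: (a) $(L_I,F_I)$ is an AOS, and $\varphi_I$ is an AOS-automorphism of it. (b) $\varphi_I$ is an involution: $\varphi_I(\varphi_I(h))=h$ for all $h\in L_I$. (c) For $i=1,2$ there is a unique $h_i\in L_I$ with $g_i\rightsquigarrow h_i$, and $\varphi_I(h_1)=h_2$. (d) In particular, if $h\in L_I$ satisfies $g_1\rightsquigarrow h$ and $g_2\rightsquigarrow h$, then $\varphi_I(h)=h$. (e) Let $J\in\mathrm{Spec}(F)$ with $J\subseteq I$ and $Z(g_1),Z(g_2)\subseteq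 J$, and let $\varphi_J:L_J\to L_J$, $\varphi_J(h)=h\,g_1\,g_2$. If $h_1\in L_J$, $h_2\in L_I$ and $h_1\rightsquigarrow h_2$, then $\varphi_J(h_1)\rightsquigarrow\varphi_I(h_2)$. -/

import Mathlib

/-- A ternary semigroup: a commutative monoid with absorbing element `0` and a distinguished
element `-1` (here `negOne`) such that `x³ = x`, `-1 ≠ 1`, `(-1)² = 1`, and
`x = -1 · x` only for `x = 0`. -/
class TernarySemigroup (S : Type*) extends CommMonoidWithZero S where
  negOne : S
  mul_self_mul_self : ∀ x : S, x * x * x = x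
  negOne_ne_one : negOne ≠ 1
  negOne_mul_negOne : negOne * negOne = 1
  eq_zero_of_eq_negOne_mul : ∀ x : S, x = negOne * x → x = 0

/-- The element `-x = (-1) · x` of a ternary semigroup. -/
def TernarySemigroup.opp {S : Type*} [TernarySemigroup S] (x : S) : S :=
  TernarySemigroup.negOne * x

/-- The transversal relation `a ∈ Dᵗ(b, c)` of a ternary relation `a ∈ D(b, c)`:
`a ∈ D(b, c)`, `-b ∈ D(-a, c)` and `-c ∈ D(b, -a)`. -/
def TernarySemigroup.Transversal {S : Type*} [TernarySemigroup S] (D : S → S → S → Prop)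
    (a b c : S) : Prop :=
  D a b c ∧ D (opp b) (opp a) c ∧ D (opp c) b (opp a)

open TernarySemigroup in
/-- A real semigroup: a ternary semigroup with a representation relation, `rep a b c` meaning
`a ∈ D(b, c)`, subject to the Dickmann-Petrovich axioms. -/
class RealSemigroup (S : Type*) extends TernarySemigroup S where
  rep : S → S → S → Prop
  rep_comm : ∀ a b c : S, rep c a b ↔ rep c b a
  rep_left : ∀ a b : S, rep a a b
  rep_mul : ∀ a b c d : S, rep a b c → rep (a * d) (b * d) (c * d)
  strong_assoc : ∀ a b c d e : S, Transversal rep a b c → Transversal rep c d e →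
    ∃ x, Transversal rep x b d ∧ Transversal rep a x e
  rep_of_rep_sq_mul : ∀ a b c d e : S, rep e (c * c * a) (d * d * b) → rep e a b
  mul_eq_of_rep : ∀ a b c d e : S, a * d = b * d → a * e = b * e → rep c d e → a * c = b * c
  transversal_of_rep : ∀ a b c : S, rep c a b → Transversal rep c (c * c * a) (c * c * b)
  reduction : ∀ a b c : S, Transversal rep c a (opp b) → Transversal rep c b (opp a) → a = b
  rep_sq : ∀ a b c : S, rep a b c → rep (a * a) (b * b) (c * c)

/-- The ternary semigroup `𝟯 = {1, 0, -1}`. -/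
instance : TernarySemigroup SignType where
  toCommMonoidWithZero := inferInstance
  negOne := -1
  mul_self_mul_self := by decide
  negOne_ne_one := by decide
  negOne_mul_negOne := by decide
  eq_zero_of_eq_negOne_mul := by decide

open TernarySemigroup in
/-- The real semigroup `𝟯 = {1, 0, -1}`, with `D(b, c) = {0, b, c}`. -/
instance : RealSemigroup SignType where
  rep a b c := a = 0 ∨ a = b ∨ a = c
  rep_comm := by decide
  rep_left := by decide
  rep_mul := by decide
  strong_assoc := by
    dsimp only [Transversal, opp]
    set_option synthInstance.maxSize 2000 in
    set_option synthInstance.maxHeartbeats 200000 in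
    set_option maxRecDepth 10000 in decide
  rep_of_rep_sq_mul := by decide
  mul_eq_of_rep := by decide
  transversal_of_rep := by dsimp only [Transversal, opp]; decide
  reduction := by dsimp only [Transversal, opp]; decide
  rep_sq := by decide

/-- Homomorphisms of ternary semigroups. -/
structure IsTSHom {S T : Type*} [TernarySemigroup S] [TernarySemigroup T] (f : S → T) :
    Prop where
  map_zero : f 0 = 0
  map_one : f 1 = 1
  map_negOne : f TernarySemigroup.negOne = TernarySemigroup.negOne
  map_mul : ∀ a b, f (a * b) = f a * f b

/-- Homomorphisms of real semigroups. -/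
structure IsRSHom {S T : Type*} [RealSemigroup S] [RealSemigroup T] (f : S → T) : Prop
    extends IsTSHom f where
  map_rep : ∀ a b c, RealSemigroup.rep a b c → RealSemigroup.rep (f a) (f b) (f c)

/-- The character space `X_F` of a real semigroup `F`: the real semigroup homomorphisms
`F → 𝟯`. -/
@[ext]
structure CharSpace (F : Type*) [RealSemigroup F] where
  toFun : F → SignType
  isRSHom : IsRSHom toFun

instance {F : Type*} [RealSemigroup F] : CoeFun (CharSpace F) (fun _ => F → SignType) :=
  ⟨CharSpace.toFun⟩

/-- The spectral topology on `X_F`, generated by the sets `{h | h a = 1}`, `a ∈ F`. -/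
instance {F : Type*} [RealSemigroup F] : TopologicalSpace (CharSpace F) :=
  TopologicalSpace.generateFrom {U | ∃ a : F, U = {h : CharSpace F | h a = 1}}

/-- The zero-set `Z(h)` of a character. -/
def CharSpace.zeros {F : Type*} [RealSemigroup F] (h : CharSpace F) : Set F := {a | h a = 0}

/-- A real semigroup is an RS-fan if every ternary semigroup character is a character of the
real semigroup, so that `X_F` consists of all ternary semigroup homomorphisms `F → 𝟯`. -/
def IsRSFan (F : Type*) [RealSemigroup F] : Prop :=
  ∀ h : F → SignType, IsTSHom h → IsRSHom h

/-- `Spec(F)`: the proper ideals of `F`. -/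
@[ext]
structure FanSpec (F : Type*) [TernarySemigroup F] where
  carrier : Set F
  zero_mem : (0 : F) ∈ carrier
  mul_mem : ∀ a b : F, b ∈ carrier → a * b ∈ carrier
  ne_univ : carrier ≠ Set.univ

/-- The level `L_I`: the characters with zero-set `I`. -/
abbrev Level {F : Type*} [RealSemigroup F] (I : FanSpec F) : Type _ :=
  {h : CharSpace F // h.zeros = I.carrier}

/-- The value set of the binary form `⟨a, b⟩` in a pair `(X, G)`. -/
def aosValues {X : Type*} (G : Subgroup (X → ℤˣ)) (a b : X → ℤˣ) : Set (X → ℤˣ) :=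
  {c | c ∈ G ∧ ∀ x, c x = a x ∨ c x = b x}

/-- Abstract order spaces `(X, G)` (Marshall): `X` is a non-empty set and `G` a group of
functions `X → {±1}` that contains the constant `-1` and separates points; every character of
`G` which maps `-1` to `-1` and whose kernel is closed under binary value sets is evaluation at
a point of `X`; and binary value sets are associative. -/
structure IsAOS (X : Type*) (G : Subgroup (X → ℤˣ)) : Prop where
  nonempty : Nonempty X
  neg_one_mem : (-1 : X → ℤˣ) ∈ G
  separates : ∀ x y : X, (∀ a ∈ G, a x = a y) → x = y
  eval_of_char : ∀ χ : G →* ℤˣ, χ ⟨-1, neg_one_mem⟩ = -1 →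
    (∀ a b c : G, χ a = 1 → χ b = 1 → (c : X → ℤˣ) ∈ aosValues G a b → χ c = 1) →
    ∃ x : X, ∀ a : G, χ a = (a : X → ℤˣ) x
  assoc : ∀ a ∈ G, ∀ b ∈ G, ∀ c ∈ G, ∀ r ∈ aosValues G b c, ∀ t ∈ aosValues G a r,
    ∃ s ∈ aosValues G a b, t ∈ aosValues G s c

/-- `φ : (X, G) → (Y, H)` is an AOS-morphism: for every `a ∈ H` there is `b ∈ G` with
`a ∘ φ = b`. -/
def IsAOSMorphism {X Y : Type*} (G : Subgroup (X → ℤˣ)) (H : Subgroup (Y → ℤˣ)) (φ : X → Y) :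
    Prop :=
  ∀ a ∈ H, ∃ b ∈ G, a ∘ φ = b

/-- `φ` is an AOS-automorphism of `(X, G)`: an invertible AOS-morphism whose inverse is an
AOS-morphism. -/
def IsAOSAutomorphism {X : Type*} (G : Subgroup (X → ℤˣ)) (φ : X → X) : Prop :=
  ∃ e : X ≃ X, (∀ x, e x = φ x) ∧ IsAOSMorphism G G e ∧ IsAOSMorphism G G e.symm

/-- The group `F_I = (F / ∼_I) ∖ {0 / ∼_I}` of the level `L_I`, where `a ∼_I b` iff
`h a = h b` for all `h ∈ L_I`. As `∼_I` is equality of the evaluation functions on `L_I`, the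
class of `a` is represented by evaluation at `a`, and `F_I` is the group of the functions
`L_I → {±1}` that are evaluation at some `a ∉ I`. -/
def levelGroup {F : Type*} [RealSemigroup F] (I : FanSpec F) : Subgroup (Level I → ℤˣ) where
  carrier := {f | ∃ a : F, a ∉ I.carrier ∧ ∀ h : Level I, ((f h : ℤˣ) : ℤ) = (h.1 a : ℤ)}
  one_mem' := by
    refine ⟨1, fun h1 => I.ne_univ (Set.eq_univ_of_forall fun x => ?_), fun h => ?_⟩
    · simpa using I.mul_mem x 1 h1
    · simp [h.1.isRSHom.map_one]
  mul_mem' := by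
    rintro f g ⟨a, ha, hf⟩ ⟨b, hb, hg⟩
    by_cases hne : Nonempty (Level I)
    · obtain ⟨h⟩ := hne
      have key : ∀ c : F, c ∈ I.carrier ↔ h.1 c = 0 := Set.ext_iff.mp h.2.symm
      refine ⟨a * b, ?_, fun k => ?_⟩
      · rw [key] at ha hb ⊢
        rw [h.1.isRSHom.map_mul]
        exact mul_ne_zero ha hb
      · rw [Pi.mul_apply, Units.val_mul, hf, hg, k.1.isRSHom.map_mul, SignType.coe_mul]
    · exact ⟨a, ha, fun k => absurd ⟨k⟩ hne⟩
  inv_mem' := by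
    rintro f ⟨a, ha, hf⟩
    refine ⟨a, ha, fun h => ?_⟩
    rw [Pi.inv_apply, Int.units_inv_eq_self]
    exact hf h

/-- A product of three characters of an RS-fan, as a character. -/
def CharSpace.mul₃ {F : Type*} [RealSemigroup F] (hF : IsRSFan F) (h g₁ g₂ : CharSpace F) :
    CharSpace F where
  toFun := fun a => h a * g₁ a * g₂ a
  isRSHom := hF _
    { map_zero := by simp [h.isRSHom.map_zero]
      map_one := by simp [h.isRSHom.map_one, g₁.isRSHom.map_one, g₂.isRSHom.map_one]
      map_negOne := by
        rw [h.isRSHom.map_negOne, g₁.isRSHom.map_negOne, g₂.isRSHom.map_negOne]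
        exact TernarySemigroup.mul_self_mul_self _
      map_mul := fun a b => by
        rw [h.isRSHom.map_mul, g₁.isRSHom.map_mul, g₂.isRSHom.map_mul]
        simp only [mul_assoc, mul_left_comm] }

/-- For characters `g₁, g₂` of an RS-fan with `Z(g₁), Z(g₂) ⊆ I`, the map
`h ↦ h · g₁ · g₂` from `L_I` to `L_I`. -/
def levelInvol {F : Type*} [RealSemigroup F] (hF : IsRSFan F) (g₁ g₂ : CharSpace F)
    (I : FanSpec F) (h₁ : g₁.zeros ⊆ I.carrier) (h₂ : g₂.zeros ⊆ I.carrier)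
    (h : Level I) : Level I :=
  ⟨CharSpace.mul₃ hF h.1 g₁ g₂, by
    have key : ∀ c : F, c ∈ I.carrier ↔ h.1 c = 0 := Set.ext_iff.mp h.2.symm
    ext a
    change h.1 a * g₁ a * g₂ a = 0 ↔ a ∈ I.carrier
    rw [mul_eq_zero, mul_eq_zero, ← key]
    exact ⟨fun H => H.elim (fun H => H.elim id fun H => h₁ H) fun H => h₂ H,
      fun H => Or.inl (Or.inl H)⟩⟩

/-! ### Characters of groups of exponent two -/

/-! In an RS-fan any two elements are comparable under divisibility (`IsRSFan.dvd_total`), so every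
proper ideal `I` is prime (`IsRSFan.mem_or_mem`). Hence a sign-valued multiplicative function off
`I` that respects `-1` extends by zero to a character (`Level.exists_extension`), and the points of
`L_I` are exactly the characters of `F_I` sending `-1` to `-1` (`levelGroup.exists_eval`). A group
of exponent two has enough characters to make binary value sets trivial
(`levelGroup.eq_or_eq_of_mem_aosValues`): `D(a, b) = {a, b}` unless `a = -b`. The AOS axioms follow.

Specialization to a point of `L_I` means agreement off `I` (`Level.specializes_iff`), so the
successor of `g` in `L_I` is `g` cut off to zero on `I`. Off `I` both `g₁` and `g₂` take values `±1`
and square to `1`; the remaining claims are computations with these signs. -/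

theorem exists_intUnits_char {G : Type*} [CommGroup G] (hG : ∀ x : G, x * x = 1)
    (H : Subgroup G) {z : G} (hz : z ∉ H) :
    ∃ χ : G →* ℤˣ, χ z = -1 ∧ ∀ x ∈ H, χ x = 1 := by
  classical
  -- Exponent two makes the group a vector space over the two-element field, where a linear
  -- functional separates a vector from a subspace.
  let : Module (ZMod 2) (Additive G) := AddCommGroup.zmodModule fun x => by
    rw [two_nsmul]; exact hG x.toMul
  let V : Submodule (ZMod 2) (Additive G) := AddSubgroup.toZModSubmodule 2 H.toAddSubgroup
  have hzV : Additive.ofMul z ∉ V := hz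
  obtain ⟨f, hfz, hfV⟩ := Submodule.exists_le_ker_of_notMem hzV
  have key : ∀ s t : ZMod 2, (if s + t = 0 then (1 : ℤˣ) else -1) =
      (if s = 0 then 1 else -1) * (if t = 0 then 1 else -1) := by decide
  refine ⟨⟨⟨fun g => if f (Additive.ofMul g) = 0 then 1 else -1, by simp⟩, fun x y => ?_⟩,
    if_neg hfz, fun x hx => if_pos (hfV hx)⟩
  simp only [ofMul_mul, map_add]
  exact key _ _

theorem exists_intUnits_char_pair {G : Type*} [CommGroup G] (hG : ∀ x : G, x * x = 1)
    {x y z : G} (h1 : z ≠ 1) (hx : z ≠ x) (hy : z ≠ y) (hxy : z ≠ x * y) :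
    ∃ χ : G →* ℤˣ, χ z = -1 ∧ χ x = 1 ∧ χ y = 1 := by
  have hpow : ∀ (w : G) (m : ℤ), w ^ m = 1 ∨ w ^ m = w := by
    intro w m
    have hw : w ^ (2 : ℤ) = 1 := by rw [zpow_two, hG]
    rcases Int.even_or_odd' m with ⟨k, rfl | rfl⟩
    · left; rw [zpow_mul, hw, one_zpow]
    · right; rw [zpow_add, zpow_mul, hw, one_zpow, one_mul, zpow_one]
  obtain ⟨χ, hχ, hH⟩ := exists_intUnits_char hG (Subgroup.closure {x, y}) (z := z) (by
    rw [Subgroup.mem_closure_pair]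
    rintro ⟨m, n, h⟩
    rcases hpow x m with hm | hm <;> rcases hpow y n with hn | hn <;>
      rw [hm, hn] at h
    · exact h1 (by simpa using h.symm)
    · exact hy (by simpa using h.symm)
    · exact hx (by simpa using h.symm)
    · exact hxy h.symm)
  exact ⟨χ, hχ, hH x (Subgroup.subset_closure (by simp)),
    hH y (Subgroup.subset_closure (by simp))⟩

/-! ### Conversion between signs and units -/

/-- The unit of `ℤ` with a given nonzero sign. -/
def SignType.toIntUnit (s : SignType) : ℤˣ := if s = 1 then 1 else -1

/-- The sign of a unit of `ℤ`. -/
def SignType.ofIntUnit (u : ℤˣ) : SignType := if u = 1 then 1 else -1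

theorem SignType.coe_toIntUnit {s : SignType} (hs : s ≠ 0) : ((s.toIntUnit : ℤˣ) : ℤ) = s := by
  revert s; decide

theorem SignType.toIntUnit_mul {s t : SignType} (hs : s ≠ 0) (ht : t ≠ 0) :
    (s * t).toIntUnit = s.toIntUnit * t.toIntUnit := by
  revert s t; decide

theorem SignType.eq_of_toIntUnit_eq {s t : SignType} (hs : s ≠ 0) (ht : t ≠ 0)
    (h : s.toIntUnit = t.toIntUnit) : s = t := by
  revert s t; decide

theorem SignType.ofIntUnit_mul (u v : ℤˣ) :
    SignType.ofIntUnit (u * v) = SignType.ofIntUnit u * SignType.ofIntUnit v := by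
  revert u v; decide

theorem SignType.ofIntUnit_ne_zero (u : ℤˣ) : SignType.ofIntUnit u ≠ 0 := by
  revert u; decide

theorem SignType.toIntUnit_ofIntUnit (u : ℤˣ) : (SignType.ofIntUnit u).toIntUnit = u := by
  revert u; decide

theorem SignType.mul_self_of_ne_zero {s : SignType} (hs : s ≠ 0) : s * s = 1 := by
  revert s; decide

theorem SignType.negOne_eq : (TernarySemigroup.negOne : SignType) = -1 := rfl

/-! ### Characters of ternary semigroups -/

namespace TernarySemigroup

variable {S : Type*} [TernarySemigroup S]

/-- The maximal subgroup of a ternary semigroup at the idempotent `e`. -/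
@[ext]
structure SquareRoots (e : S) where
  val : S
  mul_self : val * val = e

/-- The square roots of an idempotent form a group of exponent two. -/
abbrev SquareRoots.commGroup {e : S} (he : e * e = e) : CommGroup (SquareRoots e) where
  mul x y := ⟨x.val * y.val, by rw [mul_mul_mul_comm, x.mul_self, y.mul_self, he]⟩
  one := ⟨e, he⟩
  inv x := x
  mul_assoc x y z := SquareRoots.ext (mul_assoc _ _ _)
  mul_comm x y := SquareRoots.ext (mul_comm _ _)
  one_mul x := SquareRoots.ext (by
    change e * x.val = x.val
    have := mul_self_mul_self x.val
    rwa [x.mul_self] at this)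
  mul_one x := SquareRoots.ext (by
    change x.val * e = x.val
    rw [mul_comm]
    have := mul_self_mul_self x.val
    rwa [x.mul_self] at this)
  inv_mul_cancel x := SquareRoots.ext x.mul_self

/-- Localize at the idempotent `e = b²`. Since `e ≠ 0`, `-e ≠ e` in the group of square roots of
`e`, so some character `χ` of it has `χ(-e) = -1`. Put `h x = χ(xe)` when `x²e = e`, and `0`
otherwise. If `a²e = e`, then `b = a(aeb)`, so non-divisibility forces `h a = 0`. -/
theorem exists_char_of_not_dvd {a b : S} (hab : ¬ a ∣ b) :
    ∃ h : S → SignType, IsTSHom h ∧ h a = 0 ∧ h b ≠ 0 := by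
  classical
  have hb0 : b ≠ 0 := fun h => hab (h ▸ dvd_zero a)
  obtain ⟨e, hbe⟩ : ∃ e : S, e = b * b := ⟨_, rfl⟩
  have hebb : e * b = b := by rw [hbe]; exact mul_self_mul_self b
  have he : e * e = e := by
    nth_rewrite 2 [hbe]
    rw [← mul_assoc, hebb, ← hbe]
  have he0 : e ≠ 0 := fun h => hb0 (by rw [← hebb, h, zero_mul])
  let := SquareRoots.commGroup he
  have hsq : ∀ x : SquareRoots e, x * x = 1 := fun x => SquareRoots.ext x.mul_self
  have hneg : (negOne * e) * (negOne * e) = e := by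
    rw [mul_mul_mul_comm, negOne_mul_negOne, one_mul, he]
  obtain ⟨χ, hχ, -⟩ := exists_intUnits_char hsq ⊥ (z := ⟨negOne * e, hneg⟩) (by
    rw [Subgroup.mem_bot]
    intro h
    exact he0 (eq_zero_of_eq_negOne_mul e (congrArg SquareRoots.val h).symm))
  have hroot : ∀ {x : S}, x * x * e = e → (x * e) * (x * e) = e := fun {x} hx => by
    rw [mul_mul_mul_comm, he, hx]
  let h : S → SignType := fun x =>
    if hx : x * x * e = e then SignType.ofIntUnit (χ ⟨x * e, hroot hx⟩) else 0
  have hprod : ∀ x y : S, (x * y) * (x * y) * e = e ↔ x * x * e = e ∧ y * y * e = e := by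
    have aux : ∀ x y : S, (x * y) * (x * y) * e = e → x * x * e = e := fun x y hxy => by
      have : x * x * ((x * y) * (x * y) * e) = (x * y) * (x * y) * e := by
        calc x * x * ((x * y) * (x * y) * e) = (x * x * x) * x * (y * y) * e := by ac_rfl
          _ = (x * y) * (x * y) * e := by rw [mul_self_mul_self]; ac_rfl
      rwa [hxy] at this
    intro x y
    refine ⟨fun hxy => ⟨aux x y hxy, aux y x (by rwa [mul_comm y x])⟩, fun ⟨hx, hy⟩ => ?_⟩
    rw [mul_mul_mul_comm, mul_assoc, hy, hx]
  refine ⟨h, ⟨?_, ?_, ?_, fun x y => ?_⟩, ?_, ?_⟩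
  · exact dif_neg (by simpa using he0.symm)
  · have h1 : (1 : S) * 1 * e = e := by simp
    have : (⟨1 * e, hroot h1⟩ : SquareRoots e) = 1 := SquareRoots.ext (one_mul e)
    simp only [h]
    rw [dif_pos h1, this, map_one]
    rfl
  · have h1 : (negOne : S) * negOne * e = e := by rw [negOne_mul_negOne, one_mul]
    simp only [h]
    rw [dif_pos h1, hχ]
    rfl
  · by_cases hx : x * x * e = e
    · by_cases hy : y * y * e = e
      · have hxy := (hprod x y).2 ⟨hx, hy⟩
        have : (⟨x * y * e, hroot hxy⟩ : SquareRoots e) =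
            ⟨x * e, hroot hx⟩ * ⟨y * e, hroot hy⟩ := SquareRoots.ext (by
          change x * y * e = (x * e) * (y * e)
          rw [mul_mul_mul_comm, he])
        simp only [h]
        rw [dif_pos hx, dif_pos hy, dif_pos hxy, this, map_mul, SignType.ofIntUnit_mul]
      · simp only [h]
        rw [dif_neg hy, dif_neg fun hxy => hy ((hprod x y).1 hxy).2, mul_zero]
    · simp only [h]
      rw [dif_neg hx, dif_neg fun hxy => hx ((hprod x y).1 hxy).1, zero_mul]
  · refine dif_neg fun ha => hab ⟨a * e * b, ?_⟩
    calc b = a * a * e * b := by rw [ha, hebb]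
      _ = a * (a * e * b) := by ac_rfl
  · have hb : b * b * e = e := by rw [← hbe, he]
    simp only [h]
    rw [dif_pos hb]
    exact SignType.ofIntUnit_ne_zero _

end TernarySemigroup

/-! ### Ideals of real semigroup fans -/

open TernarySemigroup in
theorem RealSemigroup.exists_transversal {F : Type*} [RealSemigroup F] (a b : F) :
    ∃ x, Transversal RealSemigroup.rep x a b := by
  have h : ∀ c : F, Transversal RealSemigroup.rep 1 1 c := fun c => by
    simpa using RealSemigroup.transversal_of_rep 1 c 1 (RealSemigroup.rep_left 1 c)
  have symm : ∀ x y z : F, Transversal RealSemigroup.rep x y z →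
      Transversal RealSemigroup.rep x z y := fun x y z ⟨h1, h2, h3⟩ =>
    ⟨(RealSemigroup.rep_comm _ _ _).1 h1, (RealSemigroup.rep_comm _ _ _).1 h3,
      (RealSemigroup.rep_comm _ _ _).1 h2⟩
  -- Associativity is applied to `1 ∈ Dᵗ(a, 1)` and `1 ∈ Dᵗ(b, 1)`; its intermediate element is the
  -- one sought.
  obtain ⟨x, hx, -⟩ := RealSemigroup.strong_assoc 1 a 1 b 1 (symm _ _ _ (h a))
    (symm _ _ _ (h b))
  exact ⟨x, hx⟩

theorem IsRSHom.map_opp {F : Type*} [RealSemigroup F] {h : F → SignType} (hh : IsRSHom h)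
    (a : F) : h (TernarySemigroup.opp a) = -h a := by
  rw [TernarySemigroup.opp, hh.map_mul, hh.map_negOne, SignType.negOne_eq, neg_one_mul]

theorem IsRSHom.map_transversal {F : Type*} [RealSemigroup F] {h : F → SignType}
    (hh : IsRSHom h) {a b c : F} (H : TernarySemigroup.Transversal RealSemigroup.rep a b c) :
    TernarySemigroup.Transversal RealSemigroup.rep (h a) (h b) (h c) := by
  have hopp : ∀ s : SignType, TernarySemigroup.opp s = -s := by decide
  obtain ⟨h1, h2, h3⟩ := H
  have h1 := hh.map_rep _ _ _ h1
  have h2 := hh.map_rep _ _ _ h2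
  have h3 := hh.map_rep _ _ _ h3
  simp only [hh.map_opp] at h2 h3
  exact ⟨h1, by simpa only [hopp] using h2, by simpa only [hopp] using h3⟩

theorem SignType.ne_zero_of_transversal {s t u : SignType}
    (H : TernarySemigroup.Transversal RealSemigroup.rep s (t * t) (u * u)) :
    s = 0 ↔ t = 0 ∧ u = 0 := by
  have key : ∀ s t u : SignType,
      ((s = 0 ∨ s = t * t ∨ s = u * u) ∧
        (-(t * t) = 0 ∨ -(t * t) = -s ∨ -(t * t) = u * u) ∧
        (-(u * u) = 0 ∨ -(u * u) = t * t ∨ -(u * u) = -s)) → (s = 0 ↔ t = 0 ∧ u = 0) := by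
    decide
  have hopp : ∀ s : SignType, TernarySemigroup.opp s = -s := by decide
  obtain ⟨h1, h2, h3⟩ := H
  rw [hopp, hopp] at h2 h3
  exact key s t u ⟨h1, h2, h3⟩

namespace IsRSFan

variable {F : Type*} [RealSemigroup F] (hF : IsRSFan F)
include hF

/-- An element `c ∈ Dᵗ(a², b²)` vanishes under a character exactly when `a` and `b` both do. If
neither divides the other, take `g` killing only `a` and `k` killing only `b`. Their product `gk²`
kills both, hence `c`, so `g` or `k` already kills `c` and therefore both elements, a contradiction.
-/
theorem dvd_total (a b : F) : a ∣ b ∨ b ∣ a := by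
  by_contra! hab
  obtain ⟨g, hg, hga, hgb⟩ := TernarySemigroup.exists_char_of_not_dvd hab.1
  obtain ⟨k, hk, hkb, hka⟩ := TernarySemigroup.exists_char_of_not_dvd hab.2
  obtain ⟨c, hc⟩ := RealSemigroup.exists_transversal (a * a) (b * b)
  have key : ∀ f : F → SignType, IsTSHom f → (f c = 0 ↔ f a = 0 ∧ f b = 0) := fun f hf => by
    have H := (hF f hf).map_transversal hc
    rw [hf.map_mul, hf.map_mul] at H
    exact SignType.ne_zero_of_transversal H
  let G : CharSpace F := ⟨g, hF g hg⟩
  let K : CharSpace F := ⟨k, hF k hk⟩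
  -- The factor `k` is taken twice because only a product of an odd number of characters sends `-1`
  -- to `-1`.
  have H := key _ (CharSpace.mul₃ hF G K K).isRSHom.toIsTSHom
  change g c * k c * k c = 0 ↔ g a * k a * k a = 0 ∧ g b * k b * k b = 0 at H
  rw [hga, hkb] at H
  simp only [zero_mul, mul_zero, and_self, iff_true, mul_eq_zero, or_self_right] at H
  rcases H with H | H
  · exact hgb ((key g hg).1 H).2
  · exact hka ((key k hk).1 H).1

/-- If `b = ac`, then `ab = a²c`, and multiplying by `a` recovers `a³c = ac = b`. -/
theorem mem_or_mem (I : FanSpec F) {a b : F} (hab : a * b ∈ I.carrier) :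
    a ∈ I.carrier ∨ b ∈ I.carrier := by
  have aux : ∀ a c : F, a * (a * c) ∈ I.carrier → a * c ∈ I.carrier := fun a c h => by
    have := I.mul_mem a _ h
    rwa [show a * (a * (a * c)) = a * a * a * c by simp only [mul_assoc],
      TernarySemigroup.mul_self_mul_self] at this
  rcases hF.dvd_total a b with ⟨c, rfl⟩ | ⟨c, rfl⟩
  · exact Or.inr (aux a c hab)
  · exact Or.inl (aux b c (by rwa [mul_comm] at hab))

end IsRSFan

/-! ### Levels -/

section Level

variable {F : Type*} [RealSemigroup F]

theorem FanSpec.one_notMem (I : FanSpec F) : (1 : F) ∉ I.carrier := fun h1 =>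
  I.ne_univ (Set.eq_univ_of_forall fun x => by simpa using I.mul_mem x 1 h1)

theorem FanSpec.negOne_notMem (I : FanSpec F) :
    (TernarySemigroup.negOne : F) ∉ I.carrier := fun h => I.one_notMem (by
  simpa [TernarySemigroup.negOne_mul_negOne] using I.mul_mem TernarySemigroup.negOne _ h)

theorem FanSpec.mul_mem_iff (hF : IsRSFan F) (I : FanSpec F) {a b : F} :
    a * b ∈ I.carrier ↔ a ∈ I.carrier ∨ b ∈ I.carrier :=
  ⟨hF.mem_or_mem I, fun h => h.elim (fun h => mul_comm b a ▸ I.mul_mem b a h) (I.mul_mem a b)⟩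

theorem Level.apply_eq_zero_iff {I : FanSpec F} (h : Level I) (a : F) :
    h.1 a = 0 ↔ a ∈ I.carrier :=
  Set.ext_iff.mp h.2 a

theorem Level.ext_off {I : FanSpec F} {h k : Level I}
    (H : ∀ a ∉ I.carrier, h.1 a = k.1 a) : h = k := by
  refine Subtype.ext (CharSpace.ext (funext fun a => ?_))
  by_cases ha : a ∈ I.carrier
  · rw [(h.apply_eq_zero_iff a).2 ha, (k.apply_eq_zero_iff a).2 ha]
  · exact H a ha

/-- A sign function that is multiplicative and nonzero off the ideal `I` of a fan,
extended by zero to a character of level `I`. -/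
theorem Level.exists_extension (hF : IsRSFan F) (I : FanSpec F) (f : F → SignType)
    (hf0 : ∀ a ∉ I.carrier, f a ≠ 0) (hf1 : f 1 = 1)
    (hfn : f TernarySemigroup.negOne = TernarySemigroup.negOne)
    (hfm : ∀ a ∉ I.carrier, ∀ b ∉ I.carrier, f (a * b) = f a * f b) :
    ∃ k : Level I, ∀ a ∉ I.carrier, k.1 a = f a := by
  classical
  have hk : IsTSHom fun a => if a ∈ I.carrier then 0 else f a := by
    refine ⟨if_pos I.zero_mem, (if_neg I.one_notMem).trans hf1,
      (if_neg I.negOne_notMem).trans hfn, fun a b => ?_⟩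
    by_cases ha : a ∈ I.carrier
    · rw [if_pos ha, if_pos ((I.mul_mem_iff hF).2 (Or.inl ha)), zero_mul]
    · by_cases hb : b ∈ I.carrier
      · rw [if_pos hb, if_pos ((I.mul_mem_iff hF).2 (Or.inr hb)), mul_zero]
      · rw [if_neg ha, if_neg hb,
          if_neg fun h => ((I.mul_mem_iff hF).1 h).elim ha hb, hfm a ha b hb]
  refine ⟨⟨⟨_, hF _ hk⟩, ?_⟩, fun a ha => if_neg ha⟩
  ext a
  change (if a ∈ I.carrier then 0 else f a) = 0 ↔ a ∈ I.carrier
  by_cases ha : a ∈ I.carrier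
  · simp [ha]
  · simp [ha, hf0 a ha]

theorem CharSpace.ne_zero_of_notMem {g : CharSpace F} {I : FanSpec F}
    (hg : g.zeros ⊆ I.carrier) {a : F} (ha : a ∉ I.carrier) : g a ≠ 0 :=
  fun h => ha (hg h)

theorem CharSpace.exists_level (hF : IsRSFan F) (g : CharSpace F) (I : FanSpec F)
    (hg : g.zeros ⊆ I.carrier) : ∃ k : Level I, ∀ a ∉ I.carrier, k.1 a = g a :=
  Level.exists_extension hF I g (fun _ => CharSpace.ne_zero_of_notMem hg) g.isRSHom.map_one
    g.isRSHom.map_negOne fun a _ b _ => g.isRSHom.map_mul a b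

/-! ### Specialization and successors in a level -/

theorem CharSpace.specializes_iff {g h : CharSpace F} :
    g ⤳ h ↔ ∀ a : F, h a ≠ 0 → g a = h a := by
  have hopen : ∀ a : F, IsOpen {k : CharSpace F | k a = 1} := fun a =>
    TopologicalSpace.isOpen_generateFrom_of_mem ⟨a, rfl⟩
  have h1 : g ⤳ h ↔ ∀ a : F, h a = 1 → g a = 1 := by
    constructor
    · intro H a ha
      exact H.mem_open (hopen a) ha
    · intro H
      rw [Specializes, TopologicalSpace.nhds_generateFrom (a := h)]
      refine le_iInf₂ fun U hU => ?_
      obtain ⟨hU, a, rfl⟩ := hU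
      exact Filter.le_principal_iff.2
        ((hopen a).mem_nhds (H a hU))
  rw [h1]
  refine ⟨fun H a ha => ?_, fun H a ha => by rw [H a (by rw [ha]; decide), ha]⟩
  have hp := H a
  -- The subbasis tests only the value `1`; the value `-1` is tested at `-a`.
  have hn := H (TernarySemigroup.opp a)
  rw [g.isRSHom.map_opp, h.isRSHom.map_opp] at hn
  revert hp hn ha
  generalize g a = s
  generalize h a = t
  revert s t
  decide

theorem Level.specializes_iff {I : FanSpec F} {g : CharSpace F} {k : Level I} :
    g ⤳ k.1 ↔ ∀ a ∉ I.carrier, k.1 a = g a := by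
  rw [CharSpace.specializes_iff]
  refine forall_congr' fun a => ?_
  rw [Ne, k.apply_eq_zero_iff]
  exact imp_congr_right fun _ => eq_comm

theorem CharSpace.existsUnique_level (hF : IsRSFan F) (g : CharSpace F) (I : FanSpec F)
    (hg : g.zeros ⊆ I.carrier) : ∃! k : Level I, g ⤳ k.1 := by
  obtain ⟨k, hk⟩ := g.exists_level hF I hg
  refine ⟨k, Level.specializes_iff.2 hk, fun l hl => Level.ext_off fun a ha => ?_⟩
  rw [hk a ha, Level.specializes_iff.1 hl a ha]

/-! ### The involution of a level -/

theorem levelInvol_apply (hF : IsRSFan F) (g₁ g₂ : CharSpace F) (I : FanSpec F)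
    (h₁ : g₁.zeros ⊆ I.carrier) (h₂ : g₂.zeros ⊆ I.carrier) (h : Level I) (a : F) :
    (levelInvol hF g₁ g₂ I h₁ h₂ h).1 a = h.1 a * g₁ a * g₂ a :=
  rfl

theorem levelInvol_involutive (hF : IsRSFan F) (g₁ g₂ : CharSpace F) (I : FanSpec F)
    (h₁ : g₁.zeros ⊆ I.carrier) (h₂ : g₂.zeros ⊆ I.carrier) :
    Function.Involutive (levelInvol hF g₁ g₂ I h₁ h₂) := fun h => Level.ext_off fun a ha => by
  simp only [levelInvol_apply]
  calc h.1 a * g₁ a * g₂ a * g₁ a * g₂ a = h.1 a * (g₁ a * g₁ a) * (g₂ a * g₂ a) := by ac_rfl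
    _ = h.1 a := by
      rw [SignType.mul_self_of_ne_zero (g₁.ne_zero_of_notMem h₁ ha),
        SignType.mul_self_of_ne_zero (g₂.ne_zero_of_notMem h₂ ha), mul_one, mul_one]

theorem levelInvol_eq_of_specializes (hF : IsRSFan F) (g₁ g₂ : CharSpace F) (I : FanSpec F)
    (h₁ : g₁.zeros ⊆ I.carrier) (h₂ : g₂.zeros ⊆ I.carrier) {k₁ k₂ : Level I}
    (hk₁ : g₁ ⤳ k₁.1) (hk₂ : g₂ ⤳ k₂.1) : levelInvol hF g₁ g₂ I h₁ h₂ k₁ = k₂ :=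
  Level.ext_off fun a ha => by
    rw [levelInvol_apply, Level.specializes_iff.1 hk₁ a ha, Level.specializes_iff.1 hk₂ a ha,
      SignType.mul_self_of_ne_zero (g₁.ne_zero_of_notMem h₁ ha), one_mul]

/-! ### The level group and its order space -/

/-- The function on the level `L_I` given by evaluation at `a`. -/
def Level.eval (I : FanSpec F) (a : F) : Level I → ℤˣ := fun h => (h.1 a).toIntUnit

theorem Level.eval_mem {I : FanSpec F} {a : F} (ha : a ∉ I.carrier) :
    Level.eval I a ∈ levelGroup I :=
  ⟨a, ha, fun h => SignType.coe_toIntUnit fun h0 => ha ((h.apply_eq_zero_iff a).1 h0)⟩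

theorem Level.eval_mul {I : FanSpec F} {a b : F} (ha : a ∉ I.carrier) (hb : b ∉ I.carrier) :
    Level.eval I (a * b) = Level.eval I a * Level.eval I b := funext fun h => by
  rw [Pi.mul_apply, Level.eval, h.1.isRSHom.map_mul]
  exact SignType.toIntUnit_mul (fun h0 => ha ((h.apply_eq_zero_iff a).1 h0))
    fun h0 => hb ((h.apply_eq_zero_iff b).1 h0)

theorem Level.eval_one (I : FanSpec F) : Level.eval I (1 : F) = 1 := funext fun h => by
  rw [Level.eval, h.1.isRSHom.map_one]; rfl

theorem Level.eval_negOne (I : FanSpec F) :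
    Level.eval I (TernarySemigroup.negOne : F) = -1 := funext fun h => by
  rw [Level.eval, h.1.isRSHom.map_negOne]; rfl

theorem mem_levelGroup_iff {I : FanSpec F} {f : Level I → ℤˣ} :
    f ∈ levelGroup I ↔ ∃ a ∉ I.carrier, f = Level.eval I a := by
  constructor
  · rintro ⟨a, ha, hf⟩
    refine ⟨a, ha, funext fun h => Units.ext ?_⟩
    rw [hf h]
    exact (SignType.coe_toIntUnit fun h0 => ha ((h.apply_eq_zero_iff a).1 h0)).symm
  · rintro ⟨a, ha, rfl⟩
    exact Level.eval_mem ha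

theorem neg_one_mem_levelGroup (I : FanSpec F) : (-1 : Level I → ℤˣ) ∈ levelGroup I :=
  Level.eval_negOne I ▸ Level.eval_mem I.negOne_notMem

/-- Pulling `χ` back along evaluation gives a multiplicative sign function off `I`, which extends by
zero. No closure condition on the kernel is needed: this is the fan property of the level. -/
theorem levelGroup.exists_eval (hF : IsRSFan F) (I : FanSpec F) (χ : levelGroup I →* ℤˣ)
    (hχ : χ ⟨-1, neg_one_mem_levelGroup I⟩ = -1) :
    ∃ x : Level I, ∀ a : levelGroup I, χ a = (a : Level I → ℤˣ) x := by
  classical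
  let f : F → SignType := fun a =>
    if ha : a ∈ I.carrier then 0 else SignType.ofIntUnit (χ ⟨Level.eval I a, Level.eval_mem ha⟩)
  have hf : ∀ a (ha : a ∉ I.carrier),
      f a = SignType.ofIntUnit (χ ⟨Level.eval I a, Level.eval_mem ha⟩) := fun a ha => dif_neg ha
  obtain ⟨k, hk⟩ := Level.exists_extension hF I f
    (fun a ha => by rw [hf a ha]; exact SignType.ofIntUnit_ne_zero _)
    (by
      rw [hf 1 I.one_notMem]
      simp only [Level.eval_one]
      exact congrArg SignType.ofIntUnit χ.map_one)
    (by
      rw [hf _ I.negOne_notMem]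
      simp only [Level.eval_negOne]
      rw [hχ]
      rfl)
    (fun a ha b hb => by
      have hab : a * b ∉ I.carrier := fun h => ((I.mul_mem_iff hF).1 h).elim ha hb
      rw [hf a ha, hf b hb, hf _ hab, ← SignType.ofIntUnit_mul, ← map_mul]
      simp only [Level.eval_mul ha hb]
      rfl)
  refine ⟨k, fun ⟨b, hb⟩ => ?_⟩
  obtain ⟨a, ha, rfl⟩ := mem_levelGroup_iff.1 hb
  change _ = (k.1 a).toIntUnit
  rw [hk a ha, hf a ha, SignType.toIntUnit_ofIntUnit]

/-- Binary value sets of the level group of a fan are trivial. -/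
theorem levelGroup.eq_or_eq_of_mem_aosValues (hF : IsRSFan F) (I : FanSpec F)
    {a b c : Level I → ℤˣ} (ha : a ∈ levelGroup I) (hb : b ∈ levelGroup I)
    (hc : c ∈ aosValues (levelGroup I) a b) : c = a ∨ c = b ∨ a = -b := by
  by_contra! hne
  obtain ⟨hca, hcb, hab⟩ := hne
  obtain ⟨hc, hcx⟩ := hc
  have hsq : ∀ x : levelGroup I, x * x = 1 := fun x => Subtype.ext (funext fun h => by
    simp)
  let n : levelGroup I := ⟨-1, neg_one_mem_levelGroup I⟩
  let a' : levelGroup I := ⟨a, ha⟩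
  let b' : levelGroup I := ⟨b, hb⟩
  let c' : levelGroup I := ⟨c, hc⟩
  -- The equality `-1 = 1` of functions would make the level empty, and then `c = a` holds
  -- vacuously.
  by_cases hn : n = 1
  · have h0 : (-1 : Level I → ℤˣ) = 1 := congrArg Subtype.val hn
    refine hca (funext fun h => ?_)
    exact absurd (congrFun h0 h) (by decide : (-1 : ℤˣ) ≠ 1)
  -- A character with `χ(-1) = -1` and `χ(-ca) = χ(-cb) = 1` is a point where `c` differs from both
  -- `a` and `b`. It can fail to exist only if `-1` is one of `1`, `-ca`, `-cb`, `ab`; the last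
  -- three mean `c = a`, `c = b`, `a = -b`.
  obtain ⟨χ, hχn, hχa, hχb⟩ := exists_intUnits_char_pair hsq (x := n * (c' * a'))
    (y := n * (c' * b')) (z := n) hn
    (fun h => hca (by
      have : c' * a' = 1 := by simpa using h
      have : c' = a' := by rw [← mul_one c', ← hsq a', ← mul_assoc, this, one_mul]
      exact congrArg Subtype.val this))
    (fun h => hcb (by
      have : c' * b' = 1 := by simpa using h
      have : c' = b' := by rw [← mul_one c', ← hsq b', ← mul_assoc, this, one_mul]
      exact congrArg Subtype.val this))
    (fun h => hab (by
      have h2 : n = a' * b' := by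
        calc n = n * (c' * a') * (n * (c' * b')) := h
          _ = (n * n) * (c' * c') * (a' * b') := by ac_rfl
          _ = a' * b' := by rw [hsq, hsq, one_mul, one_mul]
      have h3 : n * b' = a' := by rw [h2, mul_assoc, hsq, mul_one]
      have h4 : (-1 : Level I → ℤˣ) * b = a := congrArg Subtype.val h3
      rw [← h4, neg_one_mul]))
  obtain ⟨x, hx⟩ := levelGroup.exists_eval hF I χ hχn
  rw [map_mul, map_mul, hχn, hx, hx] at hχa hχb
  have hχa : -1 * (c x * a x) = 1 := hχa
  have hχb : -1 * (c x * b x) = 1 := hχb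
  rcases hcx x with h | h
  · rw [h] at hχa; simp at hχa
  · rw [h] at hχb; simp at hχb

theorem mem_aosValues_left {X : Type*} {G : Subgroup (X → ℤˣ)} {a b : X → ℤˣ} (ha : a ∈ G) :
    a ∈ aosValues G a b :=
  ⟨ha, fun _ => Or.inl rfl⟩

theorem mem_aosValues_right {X : Type*} {G : Subgroup (X → ℤˣ)} {a b : X → ℤˣ} (hb : b ∈ G) :
    b ∈ aosValues G a b :=
  ⟨hb, fun _ => Or.inr rfl⟩

theorem mem_aosValues_neg {X : Type*} {G : Subgroup (X → ℤˣ)} {a b c : X → ℤˣ} (hc : c ∈ G)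
    (hab : a = -b) : c ∈ aosValues G a b :=
  ⟨hc, fun x => by
    rw [hab, Pi.neg_apply]
    exact (Int.units_eq_one_or (c x)).elim
      (fun h => (Int.units_eq_one_or (b x)).elim (fun h' => by simp [h, h'])
        fun h' => by simp [h, h'])
      fun h => (Int.units_eq_one_or (b x)).elim (fun h' => by simp [h, h'])
        fun h' => by simp [h, h']⟩

theorem levelGroup.isAOS (hF : IsRSFan F) (I : FanSpec F) (hI : Nonempty (Level I)) :
    IsAOS (Level I) (levelGroup I) where
  nonempty := hI
  neg_one_mem := neg_one_mem_levelGroup I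
  separates x y hxy := Level.ext_off fun a ha =>
    SignType.eq_of_toIntUnit_eq (fun h0 => ha ((x.apply_eq_zero_iff a).1 h0))
      (fun h0 => ha ((y.apply_eq_zero_iff a).1 h0)) (hxy _ (Level.eval_mem ha))
  eval_of_char χ hχ _ := levelGroup.exists_eval hF I χ hχ
  assoc a ha b hb c hc r hr t ht := by
    rcases eq_or_eq_of_mem_aosValues hF I ha hr.1 ht with rfl | rfl | har
    · exact ⟨t, mem_aosValues_left ha, mem_aosValues_left ha⟩
    · rcases eq_or_eq_of_mem_aosValues hF I hb hc hr with rfl | rfl | hbc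
      · exact ⟨t, mem_aosValues_right hb, mem_aosValues_left hb⟩
      · exact ⟨a, mem_aosValues_left ha, mem_aosValues_right hc⟩
      · exact ⟨b, mem_aosValues_right hb, mem_aosValues_neg ht.1 hbc⟩
    · rcases eq_or_eq_of_mem_aosValues hF I hb hc hr with rfl | rfl | hbc
      · exact ⟨t, mem_aosValues_neg ht.1 har, mem_aosValues_left ht.1⟩
      · exact ⟨a, mem_aosValues_left ha, mem_aosValues_neg ht.1 har⟩
      · exact ⟨b, mem_aosValues_right hb, mem_aosValues_neg ht.1 hbc⟩

/-- Composition with the map multiplies evaluation at `a` by the constant sign `g₁(a)g₂(a)`, and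
`-1` lies in the level group. -/
theorem levelInvol_isAOSMorphism (hF : IsRSFan F) (g₁ g₂ : CharSpace F) (I : FanSpec F)
    (h₁ : g₁.zeros ⊆ I.carrier) (h₂ : g₂.zeros ⊆ I.carrier) :
    IsAOSMorphism (levelGroup I) (levelGroup I) (levelInvol hF g₁ g₂ I h₁ h₂) := by
  intro f hf
  obtain ⟨a, ha, rfl⟩ := mem_levelGroup_iff.1 hf
  have h₁a := g₁.ne_zero_of_notMem h₁ ha
  have h₂a := g₂.ne_zero_of_notMem h₂ ha
  have hcomp : Level.eval I a ∘ levelInvol hF g₁ g₂ I h₁ h₂ =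
      fun h => Level.eval I a h * (g₁ a * g₂ a).toIntUnit := funext fun h => by
    rw [Function.comp_apply, Level.eval, levelInvol_apply, mul_assoc]
    exact SignType.toIntUnit_mul (fun h0 => ha ((h.apply_eq_zero_iff a).1 h0))
      (mul_ne_zero h₁a h₂a)
  refine ⟨_, ?_, hcomp⟩
  rcases Int.units_eq_one_or (g₁ a * g₂ a).toIntUnit with hu | hu
  · simpa only [hu, mul_one] using hf
  · have := (levelGroup I).mul_mem hf (neg_one_mem_levelGroup I)
    simp only [hu]
    exact this

theorem levelInvol_isAOSAutomorphism (hF : IsRSFan F) (g₁ g₂ : CharSpace F) (I : FanSpec F)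
    (h₁ : g₁.zeros ⊆ I.carrier) (h₂ : g₂.zeros ⊆ I.carrier) :
    IsAOSAutomorphism (levelGroup I) (levelInvol hF g₁ g₂ I h₁ h₂) :=
  ⟨(levelInvol_involutive hF g₁ g₂ I h₁ h₂).toPerm, fun _ => rfl,
    levelInvol_isAOSMorphism hF g₁ g₂ I h₁ h₂, levelInvol_isAOSMorphism hF g₁ g₂ I h₁ h₂⟩

theorem levelInvol_specializes (hF : IsRSFan F) (g₁ g₂ : CharSpace F) {I J : FanSpec F}
    (hI₁ : g₁.zeros ⊆ I.carrier) (hI₂ : g₂.zeros ⊆ I.carrier)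
    (hJ₁ : g₁.zeros ⊆ J.carrier) (hJ₂ : g₂.zeros ⊆ J.carrier)
    {k₁ : Level J} {k₂ : Level I} (hk : k₁.1 ⤳ k₂.1) :
    (levelInvol hF g₁ g₂ J hJ₁ hJ₂ k₁).1 ⤳ (levelInvol hF g₁ g₂ I hI₁ hI₂ k₂).1 :=
  Level.specializes_iff.2 fun a ha => by
    rw [levelInvol_apply, levelInvol_apply, Level.specializes_iff.1 hk a ha]

end Level

theorem theorem2p8 {F : Type*} [RealSemigroup F] (hF : IsRSFan F) (g₁ g₂ : CharSpace F)
    (I : FanSpec F) (h₁ : g₁.zeros ⊆ I.carrier) (h₂ : g₂.zeros ⊆ I.carrier) :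
    -- (a) the level is an abstract order space, and the map is an automorphism of it
    (IsAOS (Level I) (levelGroup I) ∧
      IsAOSAutomorphism (levelGroup I) (levelInvol hF g₁ g₂ I h₁ h₂)) ∧
    -- (b) the map is an involution
    (∀ h : Level I,
      levelInvol hF g₁ g₂ I h₁ h₂ (levelInvol hF g₁ g₂ I h₁ h₂ h) = h) ∧
    -- (c) unique successors exist, and the map sends that of the first to that of the second
    ((∃! k : Level I, g₁ ⤳ k.1) ∧ (∃! k : Level I, g₂ ⤳ k.1) ∧
      ∀ k₁ k₂ : Level I, g₁ ⤳ k₁.1 → g₂ ⤳ k₂.1 →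
        levelInvol hF g₁ g₂ I h₁ h₂ k₁ = k₂) ∧
    -- (d) a common specialization in the level is a fixed point
    (∀ h : Level I, g₁ ⤳ h.1 → g₂ ⤳ h.1 → levelInvol hF g₁ g₂ I h₁ h₂ h = h) ∧
    -- (e) compatibility with specialization from a lower level
    (∀ (J : FanSpec F) (hJI : J.carrier ⊆ I.carrier)
      (hJ₁ : g₁.zeros ⊆ J.carrier) (hJ₂ : g₂.zeros ⊆ J.carrier)
      (k₁ : Level J) (k₂ : Level I), k₁.1 ⤳ k₂.1 →
        (levelInvol hF g₁ g₂ J hJ₁ hJ₂ k₁).1 ⤳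
          (levelInvol hF g₁ g₂ I (hJ₁.trans hJI) (hJ₂.trans hJI) k₂).1) :=
  ⟨⟨levelGroup.isAOS hF I (g₁.existsUnique_level hF I h₁).exists.nonempty,
      levelInvol_isAOSAutomorphism hF g₁ g₂ I h₁ h₂⟩,
    levelInvol_involutive hF g₁ g₂ I h₁ h₂,
    ⟨g₁.existsUnique_level hF I h₁, g₂.existsUnique_level hF I h₂,
      fun _ _ => levelInvol_eq_of_specializes hF g₁ g₂ I h₁ h₂⟩,
    fun _ => levelInvol_eq_of_specializes hF g₁ g₂ I h₁ h₂,
    fun _ hJI hJ₁ hJ₂ _ _ =>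
      levelInvol_specializes hF g₁ g₂ (hJ₁.trans hJI) (hJ₂.trans hJI) hJ₁ hJ₂⟩
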